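/- Let $F$ be an arbitrary field and let $L$ be a finite-dimensional (left) Leibniz algebra over $F$, i.e. a finite-dimensional $F$-vector space with a bilinear product satisfying $a(bc)=(ab)c+b(ac)$ for all $a,b,c\in L$. For a subalgebra $S$ of $L$ let $S^2$ be the subalgebra spanned by all products $st$ with $s,t\in S$. Call $S$ \emph{solvable} if its derived series $S^{(0)}=S$, $S^{(n+1)}=S^{(n)}S^{(n)}$ reaches $0$; \emph{nilpotent} if its lower central series $S_0=S$, $S_{n+1}=S\,S_n$ reaches $0$; \emph{strongly solvable} if $S^2$ is nilpotent; and \emph{two-generated} if it is generated as an algebra by two (not necessarily distinct) elements. (Here $PQ$ denotes the linear span of all products $pq$ with $p\in P$, $q\in Q$.) Suppose that $L$ is solvable and that every two-generated proper subalgebra of $L$ is strongly solvable. Then \begin{enumerate} \item $L$ is strongly solvable or two-generated (or both), and \item every proper subalgebra of $L$ is strongly solvable. \end{enumerate} -/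

import Mathlib

/-- The left Leibniz identity `a(bc) = (ab)c + b(ac)`. A (left) Leibniz algebra over a field `F` is
a not necessarily associative `F`-algebra `L` (a ring and an `F`-module whose product is
`F`-bilinear) that satisfies this identity. -/
class IsLeftLeibniz (L : Type*) [NonUnitalNonAssocRing L] : Prop where
  leibniz : ∀ a b c : L, a * (b * c) = (a * b) * c + b * (a * c)

namespace Leibniz

section

variable {F L : Type*} [Field F] [NonUnitalNonAssocRing L] [Module F L]
  [IsScalarTower F L L] [SMulCommClass F L L]

/-- The product `PQ` of two subspaces: the linear span of all products `p * q` with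
`p ∈ P` and `q ∈ Q`. -/
def prod (P Q : Submodule F L) : Submodule F L :=
  Submodule.map₂ (LinearMap.mul F L) P Q

/-- The derived series `S, SS, (SS)(SS), …` of a subalgebra with underlying subspace `S`. -/
def derivedSeries (S : Submodule F L) : ℕ → Submodule F L
  | 0 => S
  | n + 1 => prod (derivedSeries S n) (derivedSeries S n)

/-- The lower central series `S, SS, S(SS), S(S(SS)), …` of a subalgebra with underlying
subspace `S` of a left Leibniz algebra. -/
def lowerCentralSeries (S : Submodule F L) : ℕ → Submodule F L
  | 0 => S
  | n + 1 => prod S (lowerCentralSeries S n)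

/-- The subalgebra `S` is solvable: its derived series reaches `0`. -/
def IsSolvable (S : NonUnitalSubalgebra F L) : Prop :=
  ∃ n : ℕ, derivedSeries S.toSubmodule n = ⊥

/-- The subalgebra `S` is nilpotent: its lower central series reaches `0`. -/
def IsNilpotent (S : NonUnitalSubalgebra F L) : Prop :=
  ∃ n : ℕ, lowerCentralSeries S.toSubmodule n = ⊥

/-- For a subalgebra `S`, the subalgebra `S²` spanned by all products of two elements of `S`. -/
def square (S : NonUnitalSubalgebra F L) : NonUnitalSubalgebra F L where
  toSubmodule := prod S.toSubmodule S.toSubmodule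
  mul_mem' {a b} ha hb := by
    have hle : prod S.toSubmodule S.toSubmodule ≤ S.toSubmodule :=
      Submodule.map₂_le.2 fun _ hm _ hn => S.mul_mem hm hn
    exact Submodule.apply_mem_map₂ (LinearMap.mul F L) (hle ha) (hle hb)

/-- The subalgebra `S` is strongly solvable: `S²` is nilpotent. -/
def IsStronglySolvable (S : NonUnitalSubalgebra F L) : Prop :=
  IsNilpotent (square S)

/-- The subalgebra `S` is two-generated: it is generated, as an algebra, by two of its elements
(not necessarily distinct). -/
def IsTwoGenerated (S : NonUnitalSubalgebra F L) : Prop :=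
  ∃ x y : L, NonUnitalAlgebra.adjoin F {x, y} = S

end

end Leibniz

/-! Everything reduces to one claim, `IsSolvable.isStronglySolvable`: a solvable algebra whose
two-generated subalgebras are all strongly solvable is itself strongly solvable. Both conclusions
apply it, to a proper subalgebra or to a whole algebra that is not two-generated. For the claim,
left multiplication by `u * v` is nilpotent on the subalgebra generated by `u` and `v`, so its
Fitting null component contains both. Climbing the derived series from `0`,
`IsTwoSided.le_leftFitting` enlarges this to the whole algebra by perturbing the two factors inside
an abelian-modulo-null-component ideal. Products thus act nilpotently one at a time;
`isNilpotent_map_mul_prod_top` makes the square act nilpotently as a whole, by an Engel-type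
argument along the derived series. -/

namespace Leibniz

/-! ### Nilpotent subspaces of associative algebras, and a dimension count -/

section Associative

/-- If `P` and `Q` are nilpotent subspaces of an associative algebra and `Q P ≤ P (P + Q + 1)`,
then `P + Q` is nilpotent. -/
theorem isNilpotent_sup_of_mul_le {F A : Type*} [Field F] [Ring A] [Algebra F A]
    {P Q : Submodule F A} (hP : _root_.IsNilpotent P) (hQ : _root_.IsNilpotent Q)
    (h : Q * P ≤ P * (P ⊔ Q ⊔ 1)) : _root_.IsNilpotent (P ⊔ Q) := by
  obtain ⟨p, hp⟩ := hP
  obtain ⟨q, hq⟩ := hQ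
  set U : Submodule F A := P ⊔ Q ⊔ 1 with hU
  have hPU : P ≤ U := le_sup_left.trans le_sup_left
  have hQU : Q ≤ U := le_sup_right.trans le_sup_left
  have h1U : 1 ≤ U := le_sup_right
  have hUP : U * P ≤ P * U := by
    rw [hU, Submodule.sup_mul, Submodule.sup_mul, ← hU]
    refine sup_le (sup_le (mul_le_mul' le_rfl hPU) h) ?_
    rw [one_mul]
    calc P = P * 1 := (mul_one P).symm
      _ ≤ P * U := mul_le_mul' le_rfl h1U
  have hUkP : ∀ k, U ^ k * P ≤ P * U ^ k := by
    intro k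
    induction k with
    | zero => simp
    | succ k ih =>
      calc U ^ (k + 1) * P = U ^ k * (U * P) := by rw [pow_succ, mul_assoc]
        _ ≤ U ^ k * (P * U) := mul_le_mul' le_rfl hUP
        _ = (U ^ k * P) * U := by rw [mul_assoc]
        _ ≤ (P * U ^ k) * U := mul_le_mul' ih le_rfl
        _ = P * U ^ (k + 1) := by rw [pow_succ, mul_assoc]
  -- A word without letters from `P` lies in `Q ^ k`; in any other, a factor `P` can be moved to the
  -- front.
  have hpow : ∀ k, (P ⊔ Q) ^ k ≤ Q ^ k ⊔ P * U ^ k := by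
    intro k
    induction k with
    | zero => simp
    | succ k ih =>
      have hQk : Q ^ k ≤ U ^ k := pow_le_pow_left' hQU k
      have hUk : U ^ k ≤ U ^ (k + 1) := by
        calc U ^ k = U ^ k * 1 := (mul_one _).symm
          _ ≤ U ^ k * U := mul_le_mul' le_rfl h1U
          _ = U ^ (k + 1) := (pow_succ _ _).symm
      calc (P ⊔ Q) ^ (k + 1) = (P ⊔ Q) * (P ⊔ Q) ^ k := pow_succ' _ _
        _ ≤ (P ⊔ Q) * (Q ^ k ⊔ P * U ^ k) := mul_le_mul' le_rfl ih
        _ ≤ Q ^ (k + 1) ⊔ P * U ^ (k + 1) := by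
          rw [Submodule.mul_sup, Submodule.sup_mul]
          refine sup_le (sup_le ?_ ?_) ?_
          · exact (mul_le_mul' le_rfl (hQk.trans hUk)).trans le_sup_right
          · rw [← pow_succ']; exact le_sup_left
          · refine le_trans ?_ le_sup_right
            calc (P ⊔ Q) * (P * U ^ k) ≤ U * (P * U ^ k) :=
                  mul_le_mul' le_sup_left le_rfl
              _ = (U * P) * U ^ k := (mul_assoc _ _ _).symm
              _ ≤ (P * U) * U ^ k := mul_le_mul' hUP le_rfl
              _ = P * U ^ (k + 1) := by rw [mul_assoc, ← pow_succ']
  have hPUp : ∀ k, (P * U ^ q) ^ k ≤ P ^ k * (U ^ q) ^ k := by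
    intro k
    induction k with
    | zero => simp
    | succ k ih =>
      calc (P * U ^ q) ^ (k + 1) = (P * U ^ q) ^ k * (P * U ^ q) := pow_succ _ _
        _ ≤ P ^ k * (U ^ q) ^ k * (P * U ^ q) := mul_le_mul' ih le_rfl
        _ = P ^ k * (U ^ (q * k) * P) * U ^ q := by rw [← pow_mul]; simp only [mul_assoc]
        _ ≤ P ^ k * (P * U ^ (q * k)) * U ^ q :=
          mul_le_mul' (mul_le_mul' le_rfl (hUkP _)) le_rfl
        _ = P ^ (k + 1) * (U ^ q) ^ (k + 1) := by
          rw [pow_mul, pow_succ P, pow_succ (U ^ q)]; simp only [mul_assoc]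
  -- Each block of `q` factors yields a `P`, since `Q ^ q = 0`; `p` blocks collect `P ^ p = 0`.
  refine ⟨q * p, ?_⟩
  have h1 : (P ⊔ Q) ^ q ≤ P * U ^ q := by simpa [hq] using hpow q
  have h2 : (P ⊔ Q) ^ (q * p) ≤ P ^ p * (U ^ q) ^ p := by
    rw [pow_mul]
    exact (pow_le_pow_left' h1 p).trans (hPUp p)
  rw [hp, zero_mul] at h2
  exact le_bot_iff.1 h2

/-- A nilpotent subspace `P` of an associative algebra stays nilpotent after adjoining nilpotent
elements `z` that commute with one another and with `P` up to elements of `P`. -/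
theorem isNilpotent_sup_span {F A : Type*} [Field F] [Ring A] [Algebra F A]
    [FiniteDimensional F A] {P : Submodule F A} (hP : _root_.IsNilpotent P) {Z : Set A}
    (hZ : ∀ z ∈ Z, _root_.IsNilpotent z) (hZP : ∀ z ∈ Z, ∀ a ∈ P, z * a - a * z ∈ P)
    (hZZ : ∀ z ∈ Z, ∀ w ∈ Z, z * w - w * z ∈ P) :
    _root_.IsNilpotent (P ⊔ Submodule.span F Z) := by
  have key : ∀ s : Finset A, (s : Set A) ⊆ Z →
      _root_.IsNilpotent (P ⊔ Submodule.span F (s : Set A)) := by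
    classical
    intro s
    induction s using Finset.induction_on with
    | empty => intro _; simpa using hP
    | insert z s hz ih =>
      intro hs
      rw [Finset.coe_insert, Set.insert_subset_iff] at hs
      have hPs := ih hs.2
      rw [Finset.coe_insert, Submodule.span_insert, sup_comm (Submodule.span F {z}), ← sup_assoc]
      refine isNilpotent_sup_of_mul_le hPs ?_ ?_
      · obtain ⟨n, hn⟩ := hZ z hs.1
        exact ⟨n, by rw [Submodule.span_pow, Set.singleton_pow, hn]; simp⟩
      · have hcomm : ∀ a ∈ P ⊔ Submodule.span F (s : Set A), z * a - a * z ∈ P := by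
          let f : A →ₗ[F] A := LinearMap.mulLeft F z - LinearMap.mulRight F z
          change P ⊔ Submodule.span F (s : Set A) ≤ P.comap f
          exact sup_le (fun a ha => hZP z hs.1 a ha)
            (Submodule.span_le.2 fun a ha => hZZ z hs.1 a (hs.2 ha))
        rw [Submodule.mul_le]
        intro w hw a ha
        obtain ⟨c, rfl⟩ := Submodule.mem_span_singleton.1 hw
        have : c • z * a = a * (c • z) + c • (z * a - a * z) * 1 := by
          simp [smul_sub]
        rw [this]
        refine add_mem (Submodule.mul_mem_mul ha ?_) (Submodule.mul_mem_mul ?_ ?_)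
        · exact Submodule.mem_sup_left (Submodule.mem_sup_right hw)
        · exact Submodule.mem_sup_left (Submodule.smul_mem _ c (hcomm a ha))
        · exact Submodule.mem_sup_right (Submodule.one_le.1 le_rfl)
  obtain ⟨t, htZ, hts⟩ := (Submodule.fg_span_iff_fg_span_finset_subset Z).1
    (IsNoetherian.noetherian (Submodule.span F Z))
  rw [hts]
  exact key t htZ

/-- If `p` is a proper subspace stable under `f` and `g`, then `f a + g b ∈ p` has a solution
`(a, b)` outside `p × p`. -/
theorem exists_notMem_map_add_map_mem {F V : Type*} [Field F] [AddCommGroup V] [Module F V]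
    [FiniteDimensional F V] (f g : V →ₗ[F] V) (p : Submodule F V) (hf : p ≤ p.comap f)
    (hg : p ≤ p.comap g) (hp : p ≠ ⊤) :
    ∃ a b, (a ∉ p ∨ b ∉ p) ∧ f a + g b ∈ p := by
  let φ : (V ⧸ p) × (V ⧸ p) →ₗ[F] V ⧸ p := (p.mapQ p f hf).coprod (p.mapQ p g hg)
  have hpos : 0 < Module.finrank F (V ⧸ p) := by
    have : Nontrivial (V ⧸ p) := Submodule.Quotient.nontrivial_iff.2 hp
    exact Module.finrank_pos
  -- The source of `φ` has twice the dimension of its nonzero target.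
  have hker : LinearMap.ker φ ≠ ⊥ := LinearMap.ker_ne_bot_of_finrank_lt (by
    rw [Module.finrank_prod]; omega)
  obtain ⟨⟨u, v⟩, huv, hne⟩ := Submodule.exists_mem_ne_zero_of_ne_bot hker
  obtain ⟨a, rfl⟩ := p.mkQ_surjective u
  obtain ⟨b, rfl⟩ := p.mkQ_surjective v
  refine ⟨a, b, ?_, ?_⟩
  · by_contra! h
    apply hne
    simp [h.1, h.2]
  · have h0 : p.mkQ (f a + g b) = 0 := by
      rw [map_add]
      simpa [φ] using huv
    rwa [← LinearMap.mem_ker, Submodule.ker_mkQ] at h0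

end Associative

/-! ### Fitting null components and nilpotent action of the square -/

section Algebra

variable {F L : Type*} [Field F] [NonUnitalNonAssocRing L] [Module F L]
  [IsScalarTower F L L] [SMulCommClass F L L]

theorem mul_mem_prod {P Q : Submodule F L} {a b : L} (ha : a ∈ P) (hb : b ∈ Q) :
    a * b ∈ prod P Q :=
  Submodule.apply_mem_map₂ (LinearMap.mul F L) ha hb

theorem prod_le {P Q R : Submodule F L} : prod P Q ≤ R ↔ ∀ a ∈ P, ∀ b ∈ Q, a * b ∈ R :=
  Submodule.map₂_le

theorem prod_mono {P P' Q Q' : Submodule F L} (hP : P ≤ P') (hQ : Q ≤ Q') :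
    prod P Q ≤ prod P' Q' :=
  Submodule.map₂_le_map₂ hP hQ

theorem derivedSeries_mono {P Q : Submodule F L} (h : P ≤ Q) :
    ∀ n, derivedSeries P n ≤ derivedSeries Q n
  | 0 => h
  | n + 1 => prod_mono (derivedSeries_mono h n) (derivedSeries_mono h n)

/-- The elements of `L` that are killed by some power of left multiplication by `z`. -/
def leftFitting (F : Type*) {L : Type*} [Field F] [NonUnitalNonAssocRing L] [Module F L]
    [IsScalarTower F L L] [SMulCommClass F L L] (z : L) : Submodule F L :=
  Module.End.maxGenEigenspace (LinearMap.mulLeft F z) 0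

theorem mem_leftFitting {z v : L} :
    v ∈ leftFitting F z ↔ ∃ n, (LinearMap.mulLeft F z ^ n) v = 0 := by
  simp [leftFitting, Module.End.mem_maxGenEigenspace]

theorem mul_mem_leftFitting_iff {z v : L} : z * v ∈ leftFitting F z ↔ v ∈ leftFitting F z := by
  simp only [mem_leftFitting]
  constructor
  · rintro ⟨n, hn⟩
    exact ⟨n + 1, by simpa [pow_succ] using hn⟩
  · rintro ⟨n, hn⟩
    refine ⟨n, ?_⟩
    have : (LinearMap.mulLeft F z ^ (n + 1)) v = 0 := by
      rw [pow_succ', Module.End.mul_apply, hn, map_zero]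
    simpa [pow_succ] using this

theorem isNilpotent_mulLeft_of_leftFitting_eq_top [FiniteDimensional F L] {z : L} (h : leftFitting F z = ⊤) :
    _root_.IsNilpotent (LinearMap.mulLeft F z) := by
  rw [Module.End.isNilpotent_iff_of_finite]
  intro v
  exact mem_leftFitting.1 (h ▸ Submodule.mem_top)

/-- A two-sided ideal of `L`. -/
def IsTwoSided (I : Submodule F L) : Prop :=
  ∀ x, ∀ a ∈ I, x * a ∈ I ∧ a * x ∈ I

variable [IsLeftLeibniz L]

/-- Left multiplication by `z` is a derivation, so each term of `z * (u * v)` lowers one of the two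
exponents. -/
theorem mul_mem_leftFitting {z u v : L} (hu : u ∈ leftFitting F z) (hv : v ∈ leftFitting F z) :
    u * v ∈ leftFitting F z := by
  obtain ⟨n, hn⟩ := mem_leftFitting.1 hu
  obtain ⟨m, hm⟩ := mem_leftFitting.1 hv
  clear hu hv
  induction n generalizing u v m with
  | zero =>
    obtain rfl : u = 0 := by simpa using hn
    simp
  | succ n ihn =>
    induction m generalizing v with
    | zero =>
      obtain rfl : v = 0 := by simpa using hm
      simp
    | succ m ihm =>
      rw [← mul_mem_leftFitting_iff, IsLeftLeibniz.leibniz]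
      exact add_mem (ihn (by simpa [pow_succ] using hn) (m + 1) hm)
        (ihm (by simpa [pow_succ] using hm))

theorem IsTwoSided.prod_self {I : Submodule F L} (hI : IsTwoSided I) : IsTwoSided (prod I I) := by
  intro x
  have h1 : prod I I ≤ (prod I I).comap (LinearMap.mulLeft F x) := prod_le.2 fun a ha b hb => by
    change x * (a * b) ∈ prod I I
    rw [IsLeftLeibniz.leibniz]
    exact add_mem (mul_mem_prod (hI x a ha).1 hb) (mul_mem_prod ha (hI x b hb).1)
  have h2 : prod I I ≤ (prod I I).comap (LinearMap.mulRight F x) := prod_le.2 fun a ha b hb => by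
    change a * b * x ∈ prod I I
    rw [eq_sub_of_add_eq (IsLeftLeibniz.leibniz a b x).symm]
    exact sub_mem (mul_mem_prod ha (hI x b hb).2) (mul_mem_prod hb (hI x a ha).2)
  exact fun a ha => ⟨h1 ha, h2 ha⟩

theorem isTwoSided_derivedSeries : ∀ n, IsTwoSided (derivedSeries (⊤ : Submodule F L) n)
  | 0 => fun _ _ _ => ⟨trivial, trivial⟩
  | n + 1 => (isTwoSided_derivedSeries n).prod_self

omit [IsScalarTower F L L] in
theorem mulLeft_commutator (u v : L) :
    LinearMap.mulLeft F u * LinearMap.mulLeft F v - LinearMap.mulLeft F v * LinearMap.mulLeft F u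
      = LinearMap.mulLeft F (u * v) := by
  ext w
  simp [IsLeftLeibniz.leibniz u v w]

variable [FiniteDimensional F L]

/-- If left multiplication by `u * v` is nilpotent on `u` and `v` for all `u` and `v`, and the
ideal `I` has its square in the Fitting null component of `x * y`, then so is `I`. -/
theorem IsTwoSided.le_leftFitting {I : Submodule F L} (hI : IsTwoSided I)
    (H : ∀ u v : L, u ∈ leftFitting F (u * v) ∧ v ∈ leftFitting F (u * v)) (x y : L)
    (hII : prod I I ≤ leftFitting F (x * y)) : I ≤ leftFitting F (x * y) := by
  set W := leftFitting F (x * y) with hW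
  obtain ⟨hx, hy⟩ := H x y
  rw [← hW] at hx hy
  by_contra hIW
  -- Choose a perturbation `(a, b)` in `I`, not entirely in `W`, that changes `x * y` only by an
  -- element of `W`.
  obtain ⟨a, b, hab, hJ⟩ := exists_notMem_map_add_map_mem
    ((LinearMap.mulRight F y).restrict (p := I) (q := I) fun a ha => (hI y a ha).2)
    ((LinearMap.mulLeft F x).restrict (p := I) (q := I) fun a ha => (hI x a ha).1)
    (W.comap I.subtype) (fun a ha => mul_mem_leftFitting ha hy)
    (fun a ha => mul_mem_leftFitting hx ha)
    (fun h => hIW fun a ha => by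
      have : (⟨a, ha⟩ : I) ∈ W.comap I.subtype := h ▸ Submodule.mem_top
      exact this)
  obtain ⟨a, ha⟩ := a
  obtain ⟨b, hb⟩ := b
  have hJ' : a * y + x * b ∈ W := hJ
  have hab' : a ∉ W ∨ b ∉ W := hab
  let z := x * y
  let j := a * y + x * b + a * b
  have hz' : (x + a) * (y + b) = z + j := by
    simp only [z, j, mul_add, add_mul]; abel
  have hjI : j ∈ I := add_mem (add_mem (hI y a ha).2 (hI x b hb).1) (hI a b hb).1
  have hjW : j ∈ W := add_mem hJ' (hII (mul_mem_prod ha hb))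
  have hzW : z ∈ W := mul_mem_leftFitting hx hy
  -- powers of left multiplication by `z` and `z + j` agree on `W ⊔ I` modulo `W`
  have hstep : ∀ u ∈ W ⊔ I, j * u ∈ W := by
    change W ⊔ I ≤ W.comap (LinearMap.mulLeft F j)
    exact sup_le (fun u hu => mul_mem_leftFitting hjW hu)
      (fun u hu => hII (mul_mem_prod hjI hu))
  have hback : ∀ n, ∀ u ∈ W ⊔ I, (LinearMap.mulLeft F (z + j) ^ n) u ∈ W → u ∈ W := by
    intro n
    induction n with
    | zero => intro u _ hu; simpa using hu
    | succ n ih =>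
      intro u hu hn
      have hju := hstep u hu
      have hzu : z * u ∈ W ⊔ I := by
        have : W ⊔ I ≤ (W ⊔ I).comap (LinearMap.mulLeft F z) :=
          sup_le (fun u hu => Submodule.mem_sup_left (mul_mem_leftFitting hzW hu))
            (fun u hu => Submodule.mem_sup_right (hI z u hu).1)
        exact this hu
      have h1 : (z + j) * u ∈ W := by
        refine ih _ ?_ (by simpa [pow_succ] using hn)
        rw [add_mul]
        exact add_mem hzu (Submodule.mem_sup_left hju)
      rw [add_mul] at h1
      exact mul_mem_leftFitting_iff.1 ((Submodule.add_mem_iff_left W hju).1 h1)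
  -- As `z + j` is again a product, `H` applies to its factors, and `hback` forces `a` and `b` into
  -- `W`.
  obtain ⟨h1, h2⟩ := H (x + a) (y + b)
  rw [hz', mem_leftFitting] at h1 h2
  have hxa : x + a ∈ W := by
    obtain ⟨n, hn⟩ := h1
    exact hback n _ (add_mem (Submodule.mem_sup_left hx) (Submodule.mem_sup_right ha))
      (hn ▸ zero_mem W)
  have hyb : y + b ∈ W := by
    obtain ⟨n, hn⟩ := h2
    exact hback n _ (add_mem (Submodule.mem_sup_left hy) (Submodule.mem_sup_right hb))
      (hn ▸ zero_mem W)
  rcases hab' with h | h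
  · exact h ((Submodule.add_mem_iff_right W hx).1 hxa)
  · exact h ((Submodule.add_mem_iff_right W hy).1 hyb)

theorem leftFitting_mul_eq_top {n : ℕ} (hn : derivedSeries (⊤ : Submodule F L) n = ⊥)
    (H : ∀ u v : L, u ∈ leftFitting F (u * v) ∧ v ∈ leftFitting F (u * v)) (x y : L) :
    leftFitting F (x * y) = ⊤ := by
  have key : ∀ k ≤ n, derivedSeries (⊤ : Submodule F L) (n - k) ≤ leftFitting F (x * y) := by
    intro k
    induction k with
    | zero => intro _; simp [hn]
    | succ k ih =>
      intro hk
      refine (isTwoSided_derivedSeries _).le_leftFitting H x y ?_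
      have := ih (by omega)
      rwa [show n - k = n - (k + 1) + 1 by omega] at this
  have := key n le_rfl
  rw [Nat.sub_self] at this
  exact top_le_iff.1 this

/-- If `L` is solvable and all left multiplications by products are nilpotent, then `L²` acts
nilpotently on `L` by left multiplications. -/
theorem isNilpotent_map_mul_prod_top {n : ℕ} (hn : derivedSeries (⊤ : Submodule F L) n = ⊥)
    (H : ∀ x y : L, _root_.IsNilpotent (LinearMap.mulLeft F (x * y))) :
    _root_.IsNilpotent ((prod (⊤ : Submodule F L) ⊤).map (LinearMap.mul F L)) := by
  -- The shift by one makes `k = n` give the first derived term, the square.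
  have key : ∀ k ≤ n, _root_.IsNilpotent
      ((derivedSeries (⊤ : Submodule F L) (n - k + 1)).map (LinearMap.mul F L)) := by
    intro k
    induction k with
    | zero =>
      intro _
      refine ⟨1, ?_⟩
      rw [pow_one, Nat.sub_zero, derivedSeries, hn]
      refine le_bot_iff.1 ?_
      rw [Submodule.map_le_iff_le_comap, prod_le]
      rintro a ha b -
      rw [(Submodule.mem_bot F).1 ha, zero_mul]
      exact zero_mem _
    | succ k ih =>
      intro hk
      set m := n - (k + 1) with hm
      have hk' := ih (by omega)
      rw [show n - k = m + 1 by omega] at hk'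
      set D := derivedSeries (⊤ : Submodule F L) m
      have hD1 : IsTwoSided (prod D D) := isTwoSided_derivedSeries (m + 1)
      have hD2 : IsTwoSided (prod (prod D D) (prod D D)) := isTwoSided_derivedSeries (m + 2)
      -- These operators are nilpotent by `H`, span the action of `prod D D`, and commute modulo the
      -- action of the next derived term.
      let Z : Set (Module.End F L) := {f | ∃ a ∈ D, ∃ b ∈ D, LinearMap.mulLeft F (a * b) = f}
      have hnil := isNilpotent_sup_span (Z := Z) hk' ?_ ?_ ?_
      · obtain ⟨r, hr⟩ := hnil
        refine ⟨r, le_bot_iff.1 (le_trans (pow_le_pow_left' ?_ r) hr.le)⟩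
        refine le_trans ?_ le_sup_right
        change (prod D D).map (LinearMap.mul F L) ≤ _
        rw [Submodule.map_le_iff_le_comap, prod_le]
        exact fun a ha b hb => Submodule.subset_span ⟨a, ha, b, hb, rfl⟩
      · rintro _ ⟨a, -, b, -, rfl⟩
        exact H a b
      · rintro _ ⟨a, ha, b, hb, rfl⟩ _ ⟨c, hc, rfl⟩
        exact ⟨a * b * c, (hD2 (a * b) c hc).1, (mulLeft_commutator (a * b) c).symm⟩
      · rintro _ ⟨a, ha, b, hb, rfl⟩ _ ⟨c, hc, d, hd, rfl⟩
        exact ⟨a * b * (c * d), mul_mem_prod (mul_mem_prod ha hb) (mul_mem_prod hc hd),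
          (mulLeft_commutator (a * b) (c * d)).symm⟩
  have := key n le_rfl
  rwa [Nat.sub_self] at this

end Algebra

/-! ### From operators to lower central series, and from subalgebras to algebras -/

section Transfer

variable {F L : Type*} [Field F] [NonUnitalNonAssocRing L] [Module F L]
  [IsScalarTower F L L] [SMulCommClass F L L]

theorem lowerCentralSeries_eq_bot_of_map_mul_pow_eq_bot {S : Submodule F L} {n : ℕ}
    (h : S.map (LinearMap.mul F L) ^ n = ⊥) : lowerCentralSeries S n = ⊥ := by
  let ev : Module.End F L →ₗ[F] L →ₗ[F] L := LinearMap.id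
  have key : ∀ n, lowerCentralSeries S n ≤
      Submodule.map₂ ev (S.map (LinearMap.mul F L) ^ n) ⊤ := by
    intro n
    induction n with
    | zero =>
      intro v _
      have h1 : (1 : Module.End F L) ∈ S.map (LinearMap.mul F L) ^ 0 := by
        rw [pow_zero]; exact (Submodule.one_le.1 le_rfl)
      exact Submodule.apply_mem_map₂ ev h1 (Submodule.mem_top (x := v))
    | succ n ih =>
      refine prod_le.2 fun a ha b hb => ?_
      have hle : Submodule.map₂ ev (S.map (LinearMap.mul F L) ^ n) ⊤ ≤
          (Submodule.map₂ ev (S.map (LinearMap.mul F L) ^ (n + 1)) ⊤).comap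
            (LinearMap.mulLeft F a) := by
        refine Submodule.map₂_le.2 fun f hf v _ => ?_
        have h1 : LinearMap.mulLeft F a * f ∈ S.map (LinearMap.mul F L) ^ (n + 1) := by
          rw [pow_succ']
          exact Submodule.mul_mem_mul (Submodule.mem_map_of_mem ha) hf
        change (LinearMap.mulLeft F a * f) v ∈ Submodule.map₂ ev _ ⊤
        exact Submodule.apply_mem_map₂ ev h1 (Submodule.mem_top (x := v))
      exact hle (ih hb)
  refine le_bot_iff.1 ((key n).trans ?_)
  rw [h, Submodule.map₂_bot_left]

theorem map_prod {S : NonUnitalSubalgebra F L} (P Q : Submodule F S) :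
    (prod P Q).map S.toSubmodule.subtype =
      prod (P.map S.toSubmodule.subtype) (Q.map S.toSubmodule.subtype) := by
  apply le_antisymm
  · rw [Submodule.map_le_iff_le_comap, prod_le]
    exact fun a ha b hb =>
      mul_mem_prod (Submodule.mem_map_of_mem ha) (Submodule.mem_map_of_mem hb)
  · rw [prod_le]
    rintro _ ⟨a, ha, rfl⟩ _ ⟨b, hb, rfl⟩
    exact ⟨_, mul_mem_prod (L := S) ha hb, rfl⟩

theorem map_derivedSeries {S : NonUnitalSubalgebra F L} (P : Submodule F S) :
    ∀ n, (derivedSeries P n).map S.toSubmodule.subtype =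
      derivedSeries (P.map S.toSubmodule.subtype) n
  | 0 => rfl
  | n + 1 => by rw [derivedSeries, map_prod, map_derivedSeries P n, derivedSeries]

theorem map_lowerCentralSeries {S : NonUnitalSubalgebra F L} (P : Submodule F S) :
    ∀ n, (lowerCentralSeries P n).map S.toSubmodule.subtype =
      lowerCentralSeries (P.map S.toSubmodule.subtype) n
  | 0 => rfl
  | n + 1 => by rw [lowerCentralSeries, map_prod, map_lowerCentralSeries P n, lowerCentralSeries]

theorem IsStronglySolvable.exists_pow_mulLeft_eq_zero {S : NonUnitalSubalgebra F L}
    (hS : IsStronglySolvable S) {x y u : L} (hx : x ∈ S) (hy : y ∈ S) (hu : u ∈ S) :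
    ∃ n, (LinearMap.mulLeft F (x * y) ^ n) u = 0 := by
  obtain ⟨n, hn⟩ := hS
  have hz : x * y ∈ (square S).toSubmodule := mul_mem_prod hx hy
  -- The extra multiplication brings `u`, which lies only in `S`, into the square.
  have key : ∀ k, (LinearMap.mulLeft F (x * y) ^ (k + 1)) u ∈
      lowerCentralSeries (square S).toSubmodule k := by
    intro k
    induction k with
    | zero =>
      rw [zero_add, pow_one]
      exact mul_mem_prod (S.mul_mem hx hy) hu
    | succ k ih =>
      rw [pow_succ', Module.End.mul_apply]
      exact mul_mem_prod hz ih
  exact ⟨n + 1, (Submodule.mem_bot F).1 (hn ▸ key n)⟩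

theorem IsSolvable.mono {S T : NonUnitalSubalgebra F L} (hT : IsSolvable T) (h : S ≤ T) :
    IsSolvable S := by
  obtain ⟨n, hn⟩ := hT
  exact ⟨n, le_bot_iff.1 (hn ▸ derivedSeries_mono (P := S.toSubmodule) (Q := T.toSubmodule) h n)⟩

/-- A solvable finite-dimensional Leibniz algebra all of whose two-generated subalgebras are
strongly solvable is strongly solvable. -/
theorem IsSolvable.isStronglySolvable [IsLeftLeibniz L] [FiniteDimensional F L]
    {S : NonUnitalSubalgebra F L} (hS : IsSolvable S)
    (h : ∀ T : NonUnitalSubalgebra F L, T ≤ S → IsTwoGenerated T → IsStronglySolvable T) :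
    IsStronglySolvable S := by
  have : IsLeftLeibniz S := ⟨fun a b c => Subtype.ext (IsLeftLeibniz.leibniz (a : L) b c)⟩
  have : FiniteDimensional F S := inferInstanceAs (FiniteDimensional F S.toSubmodule)
  have hinj : Function.Injective (Submodule.map S.toSubmodule.subtype) :=
    Submodule.map_injective_of_injective Subtype.val_injective
  have htop : (⊤ : Submodule F S).map S.toSubmodule.subtype = S.toSubmodule :=
    Submodule.map_subtype_top _
  have hpow : ∀ (z u : S) (n : ℕ),
      (((LinearMap.mulLeft F z ^ n) u : S) : L) = (LinearMap.mulLeft F (z : L) ^ n) u := by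
    intro z u n
    induction n with
    | zero => rfl
    | succ n ih =>
      rw [pow_succ', pow_succ', Module.End.mul_apply, Module.End.mul_apply, ← ih]
      rfl
  have hH : ∀ u v : S, u ∈ leftFitting F (u * v) ∧ v ∈ leftFitting F (u * v) := by
    intro u v
    have hu : (u : L) ∈ NonUnitalAlgebra.adjoin F {(u : L), (v : L)} :=
      NonUnitalAlgebra.subset_adjoin F (by simp)
    have hv : (v : L) ∈ NonUnitalAlgebra.adjoin F {(u : L), (v : L)} :=
      NonUnitalAlgebra.subset_adjoin F (by simp)
    have hT : IsStronglySolvable (NonUnitalAlgebra.adjoin F {(u : L), (v : L)}) := by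
      refine h _ (NonUnitalAlgebra.adjoin_le ?_) ⟨u, v, rfl⟩
      rintro w (rfl | rfl)
      exacts [u.2, v.2]
    refine ⟨mem_leftFitting.2 ?_, mem_leftFitting.2 ?_⟩
    · obtain ⟨n, hn⟩ := hT.exists_pow_mulLeft_eq_zero hu hv hu
      exact ⟨n, Subtype.ext ((hpow _ _ n).trans hn)⟩
    · obtain ⟨n, hn⟩ := hT.exists_pow_mulLeft_eq_zero hu hv hv
      exact ⟨n, Subtype.ext ((hpow _ _ n).trans hn)⟩
  obtain ⟨n, hn⟩ := hS
  have hn' : derivedSeries (⊤ : Submodule F S) n = ⊥ :=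
    hinj (by rw [map_derivedSeries, htop, hn, Submodule.map_bot])
  obtain ⟨m, hm⟩ := isNilpotent_map_mul_prod_top hn' fun x y =>
    isNilpotent_mulLeft_of_leftFitting_eq_top (leftFitting_mul_eq_top hn' hH x y)
  refine ⟨m, ?_⟩
  have hl := congrArg (Submodule.map S.toSubmodule.subtype)
    (lowerCentralSeries_eq_bot_of_map_mul_pow_eq_bot hm)
  rw [map_lowerCentralSeries, map_prod, htop, Submodule.map_bot] at hl
  exact hl

end Transfer

end Leibniz

theorem mainTheorem8 {F L : Type*} [Field F] [NonUnitalNonAssocRing L] [Module F L]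
    [IsScalarTower F L L] [SMulCommClass F L L] [IsLeftLeibniz L] [FiniteDimensional F L]
    (hsolv : Leibniz.IsSolvable (⊤ : NonUnitalSubalgebra F L))
    (htwo : ∀ S : NonUnitalSubalgebra F L, S ≠ ⊤ → Leibniz.IsTwoGenerated S →
      Leibniz.IsStronglySolvable S) :
    (Leibniz.IsStronglySolvable (⊤ : NonUnitalSubalgebra F L) ∨
      Leibniz.IsTwoGenerated (⊤ : NonUnitalSubalgebra F L)) ∧
    ∀ S : NonUnitalSubalgebra F L, S ≠ ⊤ → Leibniz.IsStronglySolvable S := by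
  have hproper : ∀ S : NonUnitalSubalgebra F L, S ≠ ⊤ → Leibniz.IsStronglySolvable S := by
    intro S hS
    refine (hsolv.mono le_top).isStronglySolvable fun T hT h2 => htwo T ?_ h2
    rintro rfl
    exact hS (top_le_iff.1 hT)
  refine ⟨?_, hproper⟩
  by_cases h2 : Leibniz.IsTwoGenerated (⊤ : NonUnitalSubalgebra F L)
  · exact Or.inr h2
  · refine Or.inl (hsolv.isStronglySolvable fun T _ hT => htwo T ?_ hT)
    rintro rfl
    exact h2 hT
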